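/- For every real number $p \ge 1/2$ there is a strictly increasing two-sided sequence $(x_n)_{n\in\mathbb{Z}}$ of real numbers without accumulation point in $\mathbb{R}$ such that the comb domain \[ \mathscr{M}_x := \mathbb{C}\setminus\bigcup_{n\in\mathbb{Z}} \{x_n\}\times\big((-\infty,-1]\cup[1,+\infty)\big) \] (all slit heights $b_n$ equal to $1$) has the following property: for every starting point $a\in\mathscr{M}_x$ and every planar Brownian motion $(Z_t)_{t\ge 0}$ started at $a$, the exit time $\tau_{\mathscr{M}_x}=\inf\{t\ge 0: Z_t\notin\mathscr{M}_x\}$ satisfies \[ E_a\big(\tau_{\mathscr{M}_x}^{\,p}\big)=\infty . \] -/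

import Mathlib

open MeasureTheory ProbabilityTheory
open scoped NNReal ENNReal

/-- A two-sided strictly increasing sequence of reals whose set of values has no accumulation
point in `ℝ`. -/
structure IsCombSequence (x : ℤ → ℝ) : Prop where
  strictMono : StrictMono x
  no_accPt : ∀ y : ℝ, ¬ AccPt y (Filter.principal (Set.range x))

/-- The pair of vertical slits `{c} × ((-∞, -h] ∪ [h, ∞))` in the complex plane. -/
def slit (c h : ℝ) : Set ℂ := {z | z.re = c ∧ (h ≤ z.im ∨ z.im ≤ -h)}

/-- The comb domain `ℂ ∖ ⋃ n, {x n} × ((-∞, -b n] ∪ [b n, ∞))`. -/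
def combDomain (x b : ℤ → ℝ) : Set ℂ := (⋃ n, slit (x n) (b n))ᶜ

/-- `Z` is a planar Brownian motion started at `a` under `P`: the real and imaginary parts of
`Z - a` are independent standard real Brownian motions (started at `0`, with almost surely
continuous paths). -/
structure IsPlanarBrownian {Ω : Type*} [MeasurableSpace Ω] (a : ℂ) (Z : ℝ≥0 → Ω → ℂ)
    (P : Measure Ω) : Prop where
  re : IsBrownianReal (fun t ω ↦ (Z t ω - a).re) P
  im : IsBrownianReal (fun t ω ↦ (Z t ω - a).im) P
  indep : IndepFun (fun ω (t : ℝ≥0) ↦ (Z t ω - a).re) (fun ω (t : ℝ≥0) ↦ (Z t ω - a).im) P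

/-- The exit time `inf {t ≥ 0 | Z t ∉ D}` of `Z` from `D`, equal to `∞` if `Z` never leaves `D`. -/
noncomputable def exitTime {Ω : Type*} (Z : ℝ≥0 → Ω → ℂ) (D : Set ℂ) (ω : Ω) : ℝ≥0∞ :=
  ⨅ (t : ℝ≥0) (_ : Z t ω ∉ D), (t : ℝ≥0∞)

/-! A real Brownian motion started at distance `1 / 2` from the end of a half-line stays in it up to
time `4 ^ k` with probability at least of order `2 ^ (-k)`. Hence the sum of `2 ^ k` times these
probabilities, which is a lower bound for the moments of order `p ≥ 1 / 2` up to a constant,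
diverges. In a wide enough interval finitely many terms already exceed any prescribed `K`
(`exists_le_sum_measureReal_dyadicPathsIn`).

All slits leave the strip `|Im z| < 1` open. So from any `a` the motion can enter this strip and
travel along it to the `n`-th gap, with probability at least `α * gaussianIntervalBound n (y n)`,
where `α > 0` depends on `a` but not on `n`. The gaps are chosen recursively, each so wide that the
stay there contributes `n / gaussianIntervalBound n (y n)`. The travel cost cancels, twice the
moment is at least `α * n` for all large `n`, and so it is infinite. -/

/-! ### Path events determined by countably many times -/

/-- The paths whose values at all dyadic fractions of `T` lie in `C`. -/
def dyadicPathsIn (T : ℝ≥0) (C : Set ℝ) : Set (ℝ≥0 → ℝ) :=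
  {f | ∀ m k : ℕ, k ≤ 2 ^ m → f (k / 2 ^ m * T) ∈ C}

lemma measurableSet_dyadicPathsIn (T : ℝ≥0) {C : Set ℝ} (hC : MeasurableSet C) :
    MeasurableSet (dyadicPathsIn T C) := by
  simp only [dyadicPathsIn, Set.ofPred_forall]
  exact .iInter fun m ↦ .iInter fun k ↦ .iInter fun _ ↦ measurable_pi_apply _ hC

lemma nullMeasurableSet_preimage_dyadicPathsIn {Ω : Type*} [MeasurableSpace Ω] {P : Measure Ω}
    {B : ℝ≥0 → Ω → ℝ} (hB : ∀ t, AEMeasurable (B t) P) (T : ℝ≥0) {C : Set ℝ}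
    (hC : MeasurableSet C) :
    NullMeasurableSet {ω | (fun t ↦ B t ω) ∈ dyadicPathsIn T C} P := by
  have h : {ω | (fun t ↦ B t ω) ∈ dyadicPathsIn T C} =
      ⋂ (m : ℕ) (k : ℕ) (_ : k ≤ 2 ^ m), B (k / 2 ^ m * T) ⁻¹' C := by
    ext; simp [dyadicPathsIn]
  rw [h]
  exact .iInter fun m ↦ .iInter fun k ↦ .iInter fun _ ↦ (hB _).nullMeasurable hC

/-- Dyadic fractions of `T` are dense in `[0, T]`, and continuity carries membership in a closed set
to the limit. Path events thus stay measurable for the product σ-algebra, as the independence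
statements require. -/
lemma forall_mem_of_mem_dyadicPathsIn {f : ℝ≥0 → ℝ} (hf : Continuous f) {T : ℝ≥0} {C : Set ℝ}
    (hC : IsClosed C) (h : f ∈ dyadicPathsIn T C) {t : ℝ≥0} (ht : t ≤ T) : f t ∈ C := by
  rcases eq_or_ne T 0 with rfl | hT
  · obtain rfl : t = 0 := le_antisymm ht (zero_le)
    simpa using h 0 0 (by simp)
  have hpow : Filter.Tendsto (fun m : ℕ ↦ (2 : ℝ) ^ m) Filter.atTop Filter.atTop :=
    tendsto_pow_atTop_atTop_of_one_lt (by norm_num)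
  have hlim : Filter.Tendsto (fun m : ℕ ↦ (⌊(t / T : ℝ) * 2 ^ m⌋₊ : ℝ≥0) / 2 ^ m * T) Filter.atTop
      (nhds t) := by
    have := ((tendsto_nat_floor_mul_div_atTop (R := ℝ) (a := t / T) (by positivity)).comp
      hpow).mul_const (T : ℝ)
    rw [div_mul_cancel₀ _ (by exact_mod_cast hT)] at this
    rw [← NNReal.tendsto_coe]
    simpa [Function.comp_def] using this
  refine hC.mem_of_tendsto ((hf.tendsto t).comp hlim) (Filter.Eventually.of_forall fun m ↦ ?_)
  refine h m _ (Nat.floor_le_of_le ?_)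
  push_cast
  exact mul_le_of_le_one_left (by positivity) (div_le_one_of_le₀ (by exact_mod_cast ht) T.2)

/-! ### Gaussian estimates -/

/-- By symmetry the two closed half-lines have equal mass, and they cover `ℝ`. Equality fails for `v
= 0`, where the law is a point mass at `0`. -/
lemma half_le_gaussianReal_Ici (v : ℝ≥0) : 1 / 2 ≤ (gaussianReal 0 v).real (Set.Ici 0) := by
  have hsymm : (gaussianReal 0 v).real (Set.Iic 0) = (gaussianReal 0 v).real (Set.Ici 0) := by
    have h := gaussianReal_map_neg (μ := 0) (v := v)
    rw [neg_zero] at h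
    conv_lhs => rw [← h, map_measureReal_apply measurable_neg measurableSet_Iic]
    congr 1; ext; simp
  have h1 : (gaussianReal 0 v).real (Set.Iic 0 ∪ Set.Ici 0) = 1 := by
    rw [Set.Iic_union_Ici, probReal_univ]
  have := measureReal_union_le (μ := gaussianReal 0 v) (Set.Iic 0) (Set.Ici 0)
  linarith

lemma le_gaussianReal_Icc {v : ℝ≥0} (hv : v ≠ 0) {c l R : ℝ} (hl : 0 ≤ l)
    (hR : ∀ y ∈ Set.Icc c (c + l), |y| ≤ R) :
    l * ((√(2 * Real.pi * v))⁻¹ * Real.exp (-R ^ 2 / (2 * v))) ≤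
      (gaussianReal 0 v).real (Set.Icc c (c + l)) := by
  rw [measureReal_def, gaussianReal_apply_eq_integral _ hv,
    ENNReal.toReal_ofReal (setIntegral_nonneg measurableSet_Icc fun _ _ ↦ gaussianPDFReal_nonneg ..)]
  have hint : IntegrableOn (gaussianPDFReal 0 v) (Set.Icc c (c + l)) :=
    (integrable_gaussianPDFReal 0 v).integrableOn
  calc _ = ∫ _ in Set.Icc c (c + l), (√(2 * Real.pi * v))⁻¹ * Real.exp (-R ^ 2 / (2 * v)) := by
        simp [hl]
    _ ≤ _ := by
        refine setIntegral_mono_on (integrableOn_const (by simp)) hint measurableSet_Icc fun y hy ↦ ?_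
        rw [gaussianPDFReal, sub_zero]
        have : y ^ 2 ≤ R ^ 2 := sq_le_sq' (abs_le.1 (hR y hy)).1 (abs_le.1 (hR y hy)).2
        gcongr

/-! ### Maximal inequality and probability of staying in an interval -/

namespace ProbabilityTheory.IsPreBrownianReal

variable {Ω : Type*} [MeasurableSpace Ω] {P : Measure Ω} {B : ℝ≥0 → Ω → ℝ}

lemma isProbabilityMeasure (hB : IsPreBrownianReal B P) : IsProbabilityMeasure P :=
  hB.isGaussianProcess.isProbabilityMeasure

lemma measureReal_preimage_eval (hB : IsPreBrownianReal B P) (t : ℝ≥0) {s : Set ℝ}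
    (hs : MeasurableSet s) : P.real {ω | B t ω ∈ s} = (gaussianReal 0 t).real s := by
  rw [← (hB.hasLaw_eval t).map_eq, map_measureReal_apply_of_aemeasurable (hB.aemeasurable t) hs]
  rfl

/-- The past up to `t₀` and the increments after `t₀` are independent, in terms of sets. -/
lemma measureReal_past_inter_shift (hB : IsPreBrownianReal B P) (t₀ : ℝ≥0)
    {s : Set (Set.Iic t₀ → ℝ)} (hs : MeasurableSet s) {u : Set (ℝ≥0 → ℝ)} (hu : MeasurableSet u) :
    P.real ({ω | (fun t : Set.Iic t₀ ↦ B t ω) ∈ s} ∩ {ω | (fun t ↦ B (t₀ + t) ω - B t₀ ω) ∈ u}) =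
      P.real {ω | (fun t : Set.Iic t₀ ↦ B t ω) ∈ s} *
        P.real {ω | (fun t ↦ B (t₀ + t) ω - B t₀ ω) ∈ u} := by
  simp only [measureReal_def]
  rw [← ENNReal.toReal_mul]
  congr 1
  exact (hB.indepFun_shift t₀).symm.measure_inter_preimage_eq_mul _ _ hs hu

/-- **Lévy's maximal inequality** along a finite sequence of times. -/
lemma measureReal_exists_lt_le (hB : IsPreBrownianReal B P) {t : ℕ → ℝ≥0} (ht : Monotone t)
    {T : ℝ≥0} {n : ℕ} (hT : t n ≤ T) (b : ℝ) :
    P.real {ω | ∃ k ≤ n, b < B (t k) ω} ≤ 2 * P.real {ω | b < B T ω} := by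
  have := hB.isProbabilityMeasure
  -- `E k`: the level `b` is first exceeded at index `k`. On `F k` the later increment is
  -- nonnegative, so `B T` still exceeds `b`; by independence and symmetry this keeps at least half
  -- of `E k`.
  let E : ℕ → Set Ω := fun k ↦ {ω | b < B (t k) ω ∧ ∀ j < k, B (t j) ω ≤ b}
  let F : ℕ → Set Ω := fun k ↦ E k ∩ {ω | 0 ≤ B T ω - B (t k) ω}
  have hEm : ∀ k, NullMeasurableSet (E k) P := fun k ↦ by
    simp only [E, Set.ofPred_and, Set.ofPred_forall]
    exact ((hB.aemeasurable _).nullMeasurable measurableSet_Ioi).inter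
      (.iInter fun j ↦ .iInter fun _ ↦ (hB.aemeasurable _).nullMeasurable measurableSet_Iic)
  have hFm : ∀ k, NullMeasurableSet (F k) P := fun k ↦
    (hEm k).inter (((hB.aemeasurable T).sub (hB.aemeasurable (t k))).nullMeasurable
      measurableSet_Ici)
  have hEF : ∀ k ∈ Finset.range (n + 1), P.real (E k) ≤ 2 * P.real (F k) := by
    intro k hk
    have hkT : t k ≤ T := (ht (by simpa [Nat.lt_succ_iff] using hk)).trans hT
    let s : Set (Set.Iic (t k) → ℝ) :=
      {f | b < f ⟨t k, Set.mem_Iic.2 le_rfl⟩ ∧ ∀ (j : ℕ) (h : j < k), f ⟨t j, ht h.le⟩ ≤ b}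
    have hs : MeasurableSet s := by
      simp only [s, Set.ofPred_and, Set.ofPred_forall]
      exact (measurable_pi_apply _ measurableSet_Ioi).inter
        (.iInter fun j ↦ .iInter fun _ ↦ measurable_pi_apply _ measurableSet_Iic)
    have h := hB.measureReal_past_inter_shift (t k) hs
      (measurable_pi_apply (X := fun _ : ℝ≥0 ↦ ℝ) (T - t k) (measurableSet_Ici (a := (0 : ℝ))))
    have h2 := (hB.shift (t k)).measureReal_preimage_eval (T - t k)
      (measurableSet_Ici (a := (0 : ℝ)))
    simp only [s, Set.mem_ofPred_eq, Set.mem_preimage, add_tsub_cancel_of_le hkT, Set.mem_Ici]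
      at h h2
    have h3 : P.real (F k) = P.real (E k) * (gaussianReal 0 (T - t k)).real (Set.Ici 0) := by
      rw [← h2]; exact h
    have h4 := half_le_gaussianReal_Ici (T - t k)
    rw [h3]
    nlinarith [measureReal_nonneg (μ := P) (s := E k)]
  have hsub : {ω | ∃ k ≤ n, b < B (t k) ω} ⊆ ⋃ k ∈ Finset.range (n + 1), E k := by
    rintro ω ⟨k, hk, hkb⟩
    classical
    have hex : ∃ k, b < B (t k) ω := ⟨k, hkb⟩
    simp only [Set.mem_iUnion, Finset.mem_range]
    exact ⟨Nat.find hex, by have := Nat.find_min' hex hkb; omega, Nat.find_spec hex,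
      fun j hj ↦ not_lt.1 (Nat.find_min hex hj)⟩
  have hdisj : Set.Pairwise (Finset.range (n + 1) : Set ℕ) fun i j ↦ AEDisjoint P (F i) (F j) := by
    intro i _ j _ hij
    refine Disjoint.aedisjoint (Set.disjoint_left.2 ?_)
    rintro ω ⟨⟨hi, hi'⟩, -⟩ ⟨⟨hj, hj'⟩, -⟩
    rcases hij.lt_or_gt with h | h
    · exact (hj' i h).not_gt hi
    · exact (hi' j h).not_gt hj
  calc P.real {ω | ∃ k ≤ n, b < B (t k) ω}
      ≤ P.real (⋃ k ∈ Finset.range (n + 1), E k) := measureReal_mono hsub (measure_ne_top _ _)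
    _ ≤ ∑ k ∈ Finset.range (n + 1), P.real (E k) := measureReal_biUnion_finset_le _ _
    _ ≤ ∑ k ∈ Finset.range (n + 1), 2 * P.real (F k) := Finset.sum_le_sum hEF
    _ = 2 * P.real (⋃ k ∈ Finset.range (n + 1), F k) := by
        rw [← Finset.mul_sum, measureReal_biUnion_finset₀ hdisj fun k _ ↦ hFm k]
    _ ≤ 2 * P.real {ω | b < B T ω} := by
        gcongr
        · finiteness
        simp only [Set.iUnion_subset_iff]
        rintro k - ω ⟨⟨h1, -⟩, h2⟩
        simp only [Set.mem_ofPred_eq] at h1 h2 ⊢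
        linarith

lemma measureReal_exists_dyadic_lt_le (hB : IsPreBrownianReal B P) (T : ℝ≥0) (b : ℝ) :
    P.real {ω | ∃ m k : ℕ, k ≤ 2 ^ m ∧ b < B (k / 2 ^ m * T) ω} ≤ 2 * P.real {ω | b < B T ω} := by
  have := hB.isProbabilityMeasure
  have hmono : Monotone fun m : ℕ ↦ {ω | ∃ k : ℕ, k ≤ 2 ^ m ∧ b < B (k / 2 ^ m * T) ω} := by
    refine monotone_nat_of_le_succ fun m ω ↦ ?_
    rintro ⟨k, hk, h⟩
    refine ⟨2 * k, by rw [pow_succ]; omega, ?_⟩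
    convert h using 3
    push_cast
    rw [pow_succ]
    field_simp
  have hU : {ω | ∃ m k : ℕ, k ≤ 2 ^ m ∧ b < B (k / 2 ^ m * T) ω} =
      ⋃ m : ℕ, {ω | ∃ k : ℕ, k ≤ 2 ^ m ∧ b < B (k / 2 ^ m * T) ω} := by
    ext; simp
  rw [hU]
  have hlim := (ENNReal.tendsto_toReal (measure_ne_top P _)).comp
    (tendsto_measure_iUnion_atTop (μ := P) hmono)
  refine le_of_tendsto hlim (Filter.Eventually.of_forall fun m ↦ ?_)
  refine hB.measureReal_exists_lt_le (t := fun k ↦ (k : ℝ≥0) / 2 ^ m * T) ?_ ?_ b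
  · intro i j hij
    dsimp only
    gcongr
  · simp

/-- A path that does not stay in the interval passes `c` or `-b`; the maximal inequality for `B` and
for `-B` bounds the two cases. -/
lemma one_le_measureReal_dyadicPathsIn_add (hB : IsPreBrownianReal B P) (T : ℝ≥0) (b c : ℝ) :
    1 ≤ P.real {ω | (fun t ↦ B t ω) ∈ dyadicPathsIn T (Set.Icc (-b) c)} +
      2 * P.real {ω | B T ω < -b} + 2 * P.real {ω | c < B T ω} := by
  have := hB.isProbabilityMeasure
  have h1 := hB.measureReal_exists_dyadic_lt_le T c
  have h2 := hB.neg.measureReal_exists_dyadic_lt_le T b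
  simp only [Pi.neg_apply, lt_neg (a := b)] at h2
  have huniv : (Set.univ : Set Ω) ⊆ ({ω | (fun t ↦ B t ω) ∈ dyadicPathsIn T (Set.Icc (-b) c)} ∪
      {ω | ∃ m k : ℕ, k ≤ 2 ^ m ∧ B (k / 2 ^ m * T) ω < -b}) ∪
      {ω | ∃ m k : ℕ, k ≤ 2 ^ m ∧ c < B (k / 2 ^ m * T) ω} := by
    intro ω _
    by_contra! h
    simp only [Set.mem_union, not_or, Set.mem_ofPred_eq, not_exists, not_and, not_lt] at h
    exact h.1.1 fun m k hk ↦ ⟨h.1.2 m k hk, h.2 m k hk⟩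
  have h3 := measureReal_mono (μ := P) huniv
  rw [probReal_univ] at h3
  linarith [measureReal_union_le (μ := P) ({ω | (fun t ↦ B t ω) ∈ dyadicPathsIn T (Set.Icc (-b) c)} ∪
      {ω | ∃ m k : ℕ, k ≤ 2 ^ m ∧ B (k / 2 ^ m * T) ω < -b})
      {ω | ∃ m k : ℕ, k ≤ 2 ^ m ∧ c < B (k / 2 ^ m * T) ω},
      measureReal_union_le (μ := P) {ω | (fun t ↦ B t ω) ∈ dyadicPathsIn T (Set.Icc (-b) c)}
      {ω | ∃ m k : ℕ, k ≤ 2 ^ m ∧ B (k / 2 ^ m * T) ω < -b}]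

lemma measureReal_lt_le_div_sq (hB : IsPreBrownianReal B P) (T : ℝ≥0) {c : ℝ} (hc : 0 < c) :
    P.real {ω | c < B T ω} ≤ T / c ^ 2 := by
  have := hB.isProbabilityMeasure
  have h := meas_ge_le_variance_div_sq (hB.isGaussianProcess.hasGaussianLaw_eval T).memLp_two hc
  rw [hB.integral_eval, (hB.hasLaw_eval T).variance_eq, variance_id_gaussianReal] at h
  refine (ENNReal.toReal_mono ENNReal.ofReal_ne_top
    ((measure_mono fun ω (hω : c < B T ω) ↦ ?_).trans h)).trans_eq
    (ENNReal.toReal_ofReal (by positivity))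
  simp only [Set.mem_ofPred_eq, sub_zero]
  exact hω.le.trans (le_abs_self _)

lemma measureReal_dyadicPathsIn_Icc_pos (hB : IsPreBrownianReal B P) {T : ℝ≥0} {δ : ℝ}
    (hδ : 0 < δ) (hT : 4 * T < δ ^ 2) :
    0 < P.real {ω | (fun t ↦ B t ω) ∈ dyadicPathsIn T (Set.Icc (-δ) δ)} := by
  have h1 := hB.one_le_measureReal_dyadicPathsIn_add T δ δ
  have h2 := hB.measureReal_lt_le_div_sq T hδ
  have h3 := hB.neg.measureReal_lt_le_div_sq T hδ
  simp only [Pi.neg_apply, lt_neg (a := δ)] at h3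
  have : 4 * (T / δ ^ 2) < 1 := by
    rw [← mul_div_assoc, div_lt_one (by positivity)]; exact hT
  linarith

/-- By symmetry `1 - 2 * P (B T < -b)` is the probability of `|B T| ≤ b`. This keeps the sharp order
at the near end `-b`, while Chebyshev suffices at the far end `c`. -/
lemma le_measureReal_dyadicPathsIn_Icc (hB : IsPreBrownianReal B P) (T : ℝ≥0) {b c : ℝ}
    (hb : 0 ≤ b) (hc : 0 < c) :
    P.real {ω | B T ω ∈ Set.Icc (-b) b} - 2 * (T / c ^ 2) ≤
      P.real {ω | (fun t ↦ B t ω) ∈ dyadicPathsIn T (Set.Icc (-b) c)} := by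
  have := hB.isProbabilityMeasure
  have h1 := hB.one_le_measureReal_dyadicPathsIn_add T b c
  have h2 := hB.measureReal_lt_le_div_sq T hc
  have hsymm : P.real {ω | b < B T ω} = P.real {ω | B T ω < -b} := by
    have e1 := hB.measureReal_preimage_eval T (measurableSet_Ioi (a := b))
    have e2 := hB.neg.measureReal_preimage_eval T (measurableSet_Ioi (a := b))
    simp only [Set.mem_Ioi, Pi.neg_apply, lt_neg (a := b)] at e1 e2
    rw [e1, e2]
  have m1 : NullMeasurableSet {ω | b < B T ω} P :=
    (hB.aemeasurable T).nullMeasurable measurableSet_Ioi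
  have m2 : NullMeasurableSet {ω | B T ω ∈ Set.Icc (-b) b} P :=
    (hB.aemeasurable T).nullMeasurable measurableSet_Icc
  have u1 := measureReal_union₀ (μ := P) (s := {ω | B T ω < -b}) m1
    (Disjoint.aedisjoint (Set.disjoint_left.2 fun ω (h : B T ω < -b) (h' : b < B T ω) ↦ by
      linarith))
  have u2 := measureReal_union₀ (μ := P) (s := {ω | B T ω < -b} ∪ {ω | b < B T ω}) m2
    (Disjoint.aedisjoint (Set.disjoint_left.2 fun ω h h' ↦ by
      simp only [Set.mem_union, Set.mem_ofPred_eq, Set.mem_Icc] at h h'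
      rcases h with h | h <;> linarith))
  have := measureReal_le_one (μ := P)
    (s := ({ω | B T ω < -b} ∪ {ω | b < B T ω}) ∪ {ω | B T ω ∈ Set.Icc (-b) b})
  linarith

end ProbabilityTheory.IsPreBrownianReal

-- Weighted sums of survival probabilities and moments

universe u

/-- For a wide enough interval, the weighted sum of the probabilities that a Brownian motion
started at distance `1 / 2` of its left end stays in it until time `4 ^ k` is arbitrarily large. -/
lemma exists_le_sum_measureReal_dyadicPathsIn (K : ℝ) : ∃ (L : ℝ) (m : ℕ), 0 < L ∧
    ∀ (Ω : Type u) [MeasurableSpace Ω] (P : Measure Ω) (B : ℝ≥0 → Ω → ℝ), IsPreBrownianReal B P →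
      K ≤ ∑ k ∈ Finset.range m, 2 ^ k *
        P.real {ω | (fun t ↦ B t ω) ∈ dyadicPathsIn (4 ^ k) (Set.Icc (-(1 / 2)) L)} := by
  -- `c / 2 ^ k` is a lower bound on `[-1/2, 1/2]` for the Gaussian density of variance `4 ^ k`.
  set c : ℝ := (√(2 * Real.pi))⁻¹ * Real.exp (-(1 / 8)) with hc
  have hc0 : 0 < c := by positivity
  obtain ⟨m, hm⟩ := exists_nat_gt (2 * K / c)
  have hLpos : (0 : ℝ) < 4 * 8 ^ m / c := by positivity
  -- With `L ^ 2 = 4 * 8 ^ m / c` the Chebyshev loss `2 * 4 ^ k / L ^ 2` is at most half of `c / 2 ^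
  -- k` for every `k ≤ m`, so each term of the sum is at least `c / 2`.
  refine ⟨√(4 * 8 ^ m / c), m, Real.sqrt_pos.2 hLpos, fun Ω _ P B hB ↦ ?_⟩
  have key : ∀ k ∈ Finset.range m, c / 2 ≤ 2 ^ k * P.real {ω | (fun t ↦ B t ω) ∈
      dyadicPathsIn (4 ^ k) (Set.Icc (-(1 / 2)) √(4 * 8 ^ m / c))} := by
    intro k hk
    have hkm : k ≤ m := (Finset.mem_range.1 hk).le
    have h1 := hB.le_measureReal_dyadicPathsIn_Icc (4 ^ k) (b := 1 / 2) (by norm_num)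
      (Real.sqrt_pos.2 hLpos)
    have h2 := le_gaussianReal_Icc (v := 4 ^ k) (by positivity) (c := -(1 / 2)) (l := 1) (R := 1 / 2)
      (by norm_num) (fun y hy ↦ abs_le.2 ⟨hy.1, by linarith [hy.2]⟩)
    rw [show (-(1 / 2) + 1 : ℝ) = 1 / 2 by norm_num,
      ← hB.measureReal_preimage_eval (4 ^ k) measurableSet_Icc] at h2
    rw [Real.sq_sqrt hLpos.le] at h1
    have h3 : c / 2 ^ k ≤ 1 * ((√(2 * Real.pi * (4 ^ k : ℝ≥0)))⁻¹ *
        Real.exp (-(1 / 2) ^ 2 / (2 * (4 ^ k : ℝ≥0)))) := by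
      have hs : √(2 * Real.pi * (4 ^ k : ℝ≥0)) = √(2 * Real.pi) * 2 ^ k := by
        rw [Real.sqrt_mul (by positivity)]
        congr 1
        rw [Real.sqrt_eq_iff_mul_self_eq (by positivity) (by positivity)]
        push_cast
        rw [← mul_pow]; norm_num
      have he : Real.exp (-(1 / 8)) ≤ Real.exp (-(1 / 2) ^ 2 / (2 * (4 ^ k : ℝ≥0))) := by
        apply Real.exp_le_exp.2
        push_cast
        have : (1 : ℝ) ≤ 4 ^ k := one_le_pow₀ (by norm_num)
        rw [neg_div, neg_le_neg_iff, div_le_iff₀ (by positivity)]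
        linarith
      rw [one_mul, hs, mul_inv, hc, mul_div_right_comm, div_eq_mul_inv]
      gcongr
    have h4 : (2 : ℝ) * ((4 ^ k : ℝ≥0) / (4 * 8 ^ m / c)) ≤ c / 2 ^ k / 2 := by
      have h8 : (8 : ℝ) ^ k ≤ 8 ^ m := pow_le_pow_right₀ (by norm_num) hkm
      have h48 : (4 : ℝ) ^ k * 2 ^ k = 8 ^ k := by rw [← mul_pow]; norm_num
      push_cast
      rw [div_div, ← mul_div_assoc, div_le_div_iff₀ (by positivity) (by positivity)]
      field_simp
      nlinarith
    have h5 : c / 2 ^ k / 2 ≤ P.real {ω | (fun t ↦ B t ω) ∈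
      dyadicPathsIn (4 ^ k) (Set.Icc (-(1 / 2)) √(4 * 8 ^ m / c))} := by linarith
    calc c / 2 = 2 ^ k * (c / 2 ^ k / 2) := by field_simp
      _ ≤ _ := by gcongr
  calc K ≤ m * (c / 2) := by rw [div_lt_iff₀ hc0] at hm; linarith
    _ = ∑ k ∈ Finset.range m, c / 2 := by simp
    _ ≤ _ := Finset.sum_le_sum key

/-- The geometric sum is controlled by its last nonzero term `2 ^ k`, where `4 ^ k ≤ t`; then `2 ^ k
≤ t ^ (1 / 2) ≤ t ^ p` because `t ≥ 1`. -/
lemma sum_two_pow_ite_le_rpow {p : ℝ} (hp : 1 / 2 ≤ p) (t : ℝ≥0∞) (m : ℕ) :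
    ∑ k ∈ Finset.range m, (2 : ℝ≥0∞) ^ k * (if 4 ^ k ≤ t then 1 else 0) ≤ 2 * t ^ p := by
  induction m with
  | zero => simp
  | succ m ih =>
    by_cases h : 4 ^ m ≤ t
    · have hgeom : ∑ k ∈ Finset.range (m + 1), (2 : ℝ≥0∞) ^ k ≤ 2 * 2 ^ m := by
        have : ∑ k ∈ Finset.range (m + 1), 2 ^ k ≤ 2 * 2 ^ m := by
          rw [Nat.geomSum_eq le_rfl, pow_succ]; omega
        exact_mod_cast this
      have hpow : (2 : ℝ≥0∞) ^ m ≤ t ^ p := by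
        have h1 : (1 : ℝ≥0∞) ≤ t := (one_le_pow₀ (by norm_num)).trans h
        calc (2 : ℝ≥0∞) ^ m = (4 ^ m : ℝ≥0∞) ^ (1 / 2 : ℝ) := by
              rw [show (4 : ℝ≥0∞) = 2 ^ (2 : ℝ) by norm_num, ← ENNReal.rpow_natCast,
                ← ENNReal.rpow_natCast, ← ENNReal.rpow_mul, ← ENNReal.rpow_mul]
              congr 1; ring
          _ ≤ t ^ (1 / 2 : ℝ) := ENNReal.rpow_le_rpow h (by norm_num)
          _ ≤ t ^ p := ENNReal.rpow_le_rpow_of_exponent_le h1 hp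
      calc _ ≤ ∑ k ∈ Finset.range (m + 1), (2 : ℝ≥0∞) ^ k := by
            gcongr with k
            split_ifs <;> simp
        _ ≤ 2 * 2 ^ m := hgeom
        _ ≤ _ := by gcongr
    · rw [Finset.sum_range_succ, if_neg h, mul_zero, add_zero]
      exact ih

/-- If `f ≥ 4 ^ k` on `A k`, then the weighted sum of the `P (A k)` bounds the moments of `f`. -/
lemma sum_two_pow_mul_measureReal_le_lintegral_rpow {Ω : Type*} [MeasurableSpace Ω] {P : Measure Ω}
    [IsFiniteMeasure P] {f : Ω → ℝ≥0∞} {A : ℕ → Set Ω} (hA : ∀ k, NullMeasurableSet (A k) P)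
    (hf : ∀ᵐ ω ∂P, ∀ k, ω ∈ A k → 4 ^ k ≤ f ω) {p : ℝ} (hp : 1 / 2 ≤ p) (m : ℕ) :
    ENNReal.ofReal (∑ k ∈ Finset.range m, 2 ^ k * P.real (A k)) ≤ 2 * ∫⁻ ω, f ω ^ p ∂P := by
  have hm (k : ℕ) : AEMeasurable (fun ω ↦ (2 : ℝ≥0∞) ^ k * (A k).indicator 1 ω) P :=
    (AEMeasurable.indicator₀ aemeasurable_one (hA k)).const_mul _
  calc ENNReal.ofReal (∑ k ∈ Finset.range m, 2 ^ k * P.real (A k))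
      = ∑ k ∈ Finset.range m, 2 ^ k * P (A k) := by
        rw [ENNReal.ofReal_sum_of_nonneg fun _ _ ↦ by positivity]
        refine Finset.sum_congr rfl fun k _ ↦ ?_
        rw [ENNReal.ofReal_mul (by positivity), ofReal_measureReal, ENNReal.ofReal_pow (by norm_num)]
        simp
    _ = ∫⁻ ω, ∑ k ∈ Finset.range m, 2 ^ k * (A k).indicator 1 ω ∂P := by
        rw [lintegral_finsetSum' _ fun k _ ↦ hm k]
        refine Finset.sum_congr rfl fun k _ ↦ ?_
        rw [lintegral_const_mul' _ _ (by finiteness), lintegral_indicator_one₀ (hA k)]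
    _ ≤ ∫⁻ ω, 2 * f ω ^ p ∂P := by
        refine lintegral_mono_ae (hf.mono fun ω hω ↦ ?_)
        refine le_trans ?_ (sum_two_pow_ite_le_rpow hp (f ω) m)
        gcongr with k
        by_cases h : ω ∈ A k
        · simp [h, hω k h]
        · simp [h]
    _ = 2 * ∫⁻ ω, f ω ^ p ∂P := lintegral_const_mul' _ _ (by finiteness)

/-! ### Independent stages of the motion and the exit time -/

namespace ProbabilityTheory.IsPreBrownianReal

variable {Ω : Type*} [MeasurableSpace Ω] {P : Measure Ω} {B : ℝ≥0 → Ω → ℝ}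

lemma measureReal_eval_inter_shift_dyadicPathsIn (hB : IsPreBrownianReal B P) (s h : ℝ≥0)
    {C C' : Set ℝ} (hC : MeasurableSet C) (hC' : MeasurableSet C') :
    P.real ({ω | B s ω ∈ C} ∩ {ω | (fun t ↦ B (s + t) ω - B s ω) ∈ dyadicPathsIn h C'}) =
      P.real {ω | B s ω ∈ C} *
        P.real {ω | (fun t ↦ B (s + t) ω - B s ω) ∈ dyadicPathsIn h C'} :=
  hB.measureReal_past_inter_shift s
    (measurable_pi_apply (X := fun _ : Set.Iic s ↦ ℝ) ⟨s, Set.mem_Iic.2 le_rfl⟩ hC)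
    (measurableSet_dyadicPathsIn h hC')

lemma measureReal_dyadicPathsIn_inter_increment_inter_shift (hB : IsPreBrownianReal B P)
    (s h T : ℝ≥0) {C C' C'' : Set ℝ} (hC : MeasurableSet C) (hC' : MeasurableSet C')
    (hC'' : MeasurableSet C'') :
    P.real (({ω | (fun t ↦ B t ω) ∈ dyadicPathsIn s C} ∩ {ω | B (s + h) ω - B s ω ∈ C'}) ∩
        {ω | (fun t ↦ B (s + h + t) ω - B (s + h) ω) ∈ dyadicPathsIn T C''}) =
      P.real {ω | (fun t ↦ B t ω) ∈ dyadicPathsIn s C} * P.real {ω | B (s + h) ω - B s ω ∈ C'} *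
        P.real {ω | (fun t ↦ B (s + h + t) ω - B (s + h) ω) ∈ dyadicPathsIn T C''} := by
  have hle (m k : ℕ) (hk : k ≤ 2 ^ m) : (k : ℝ≥0) / 2 ^ m * s ≤ s :=
    mul_le_of_le_one_left (zero_le) (div_le_one_of_le₀ (by exact_mod_cast hk) (zero_le))
  -- The event up to time `s`, read on coordinates up to any `r ≥ s`, so that independence can be
  -- used both at `s` and at `s + h`.
  let S (r : ℝ≥0) (hr : s ≤ r) : Set (Set.Iic r → ℝ) :=
    {f | ∀ (m k : ℕ) (hk : k ≤ 2 ^ m), f ⟨k / 2 ^ m * s, (hle m k hk).trans hr⟩ ∈ C}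
  have hS (r : ℝ≥0) (hr : s ≤ r) : MeasurableSet (S r hr) := by
    simp only [S, Set.ofPred_forall]
    exact .iInter fun m ↦ .iInter fun k ↦ .iInter fun hk ↦ measurable_pi_apply _ hC
  have h1 := hB.measureReal_past_inter_shift s (hS s le_rfl)
    (measurable_pi_apply (X := fun _ : ℝ≥0 ↦ ℝ) h hC')
  have hev (r : Set.Iic (s + h)) : Measurable fun f : Set.Iic (s + h) → ℝ ↦ f r :=
    measurable_pi_apply r
  have hinc : MeasurableSet {f : Set.Iic (s + h) → ℝ |
      f ⟨s + h, Set.mem_Iic.2 le_rfl⟩ - f ⟨s, Set.mem_Iic.2 le_self_add⟩ ∈ C'} :=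
    ((hev _).sub (hev _)) hC'
  have h2 := hB.measureReal_past_inter_shift (s + h) ((hS (s + h) le_self_add).inter hinc)
    (measurableSet_dyadicPathsIn T hC'')
  refine h2.trans ?_
  congr 1

end ProbabilityTheory.IsPreBrownianReal

lemma le_exitTime {Ω : Type*} [MeasurableSpace Ω] {Z : ℝ≥0 → Ω → ℂ} {D : Set ℂ} {ω : Ω} {T : ℝ≥0}
    (h : ∀ t < T, Z t ω ∈ D) : T ≤ exitTime Z D ω := by
  refine le_iInf₂ fun t ht ↦ ?_
  by_contra! hlt
  exact ht (h t (by exact_mod_cast hlt))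

/-- Lower bound for the moments of the exit time from a domain which contains the horizontal strip
`|Im z| < 1` and a wide vertical strip: the motion first moves into the horizontal strip (trivially
if `s = 0`), then travels inside it to the wide strip. -/
lemma IsPlanarBrownian.ofReal_le_lintegral_exitTime_rpow {Ω : Type*} [MeasurableSpace Ω]
    {P : Measure Ω} [IsProbabilityMeasure P] {a : ℂ} {Z : ℝ≥0 → Ω → ℂ}
    (hZ : IsPlanarBrownian a Z P) {D : Set ℂ} {s h : ℝ≥0} {δ η u v ξ L : ℝ} (hδ : δ ≤ 1 / 4)
    (hs : s = 0 ∨ ∀ z : ℂ, |z.re - a.re| ≤ δ → z ∈ D)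
    (hu : -1 < a.im + u - η) (hv : a.im + v + η < 1) (hD : ∀ z : ℂ, |z.im| < 1 → z ∈ D)
    (hξ : ∀ z : ℂ, ξ < z.re → z.re < ξ + 2 + L → z ∈ D) {p : ℝ} (hp : 1 / 2 ≤ p) (m : ℕ) :
    ENNReal.ofReal (P.real {ω | (Z s ω - a).im ∈ Set.Icc u v} *
      P.real {ω | (fun t ↦ (Z (s + t) ω - a).im - (Z s ω - a).im) ∈
        dyadicPathsIn h (Set.Icc (-η) η)} *
      P.real {ω | (fun t ↦ (Z t ω - a).re) ∈ dyadicPathsIn s (Set.Icc (-δ) δ)} *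
      P.real {ω | (Z (s + h) ω - a).re - (Z s ω - a).re ∈
        Set.Icc (ξ + 1 - a.re) (ξ + 1 - a.re + 1 / 2)} *
      ∑ k ∈ Finset.range m, 2 ^ k *
        P.real {ω | (fun t ↦ (Z (s + h + t) ω - a).re - (Z (s + h) ω - a).re) ∈
          dyadicPathsIn (4 ^ k) (Set.Icc (-(1 / 2)) L)}) ≤
      2 * ∫⁻ ω, exitTime Z D ω ^ p ∂P := by
  set M : Set Ω := {ω | (Z s ω - a).im ∈ Set.Icc u v} ∩
    {ω | (fun t ↦ (Z (s + t) ω - a).im - (Z s ω - a).im) ∈ dyadicPathsIn h (Set.Icc (-η) η)}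
    with hM
  set R : ℕ → Set Ω := fun k ↦
    ({ω | (fun t ↦ (Z t ω - a).re) ∈ dyadicPathsIn s (Set.Icc (-δ) δ)} ∩
      {ω | (Z (s + h) ω - a).re - (Z s ω - a).re ∈
        Set.Icc (ξ + 1 - a.re) (ξ + 1 - a.re + 1 / 2)}) ∩
    {ω | (fun t ↦ (Z (s + h + t) ω - a).re - (Z (s + h) ω - a).re) ∈
      dyadicPathsIn (4 ^ k) (Set.Icc (-(1 / 2)) L)} with hR
  have mre := hZ.re.aemeasurable
  have mim := hZ.im.aemeasurable
  have hMm : NullMeasurableSet M P :=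
    ((mim s).nullMeasurable measurableSet_Icc).inter
      (nullMeasurableSet_preimage_dyadicPathsIn (B := fun t ω ↦ (Z (s + t) ω - a).im - (Z s ω - a).im)
        (fun t ↦ (mim (s + t)).sub (mim s)) h measurableSet_Icc)
  have hRm (k : ℕ) : NullMeasurableSet (R k) P :=
    ((nullMeasurableSet_preimage_dyadicPathsIn mre s measurableSet_Icc).inter
      (((mre (s + h)).sub (mre s)).nullMeasurable measurableSet_Icc)).inter
      (nullMeasurableSet_preimage_dyadicPathsIn
        (B := fun t ω ↦ (Z (s + h + t) ω - a).re - (Z (s + h) ω - a).re)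
        (fun t ↦ (mre (s + h + t)).sub (mre (s + h))) (4 ^ k) measurableSet_Icc)
  have hMR (k : ℕ) : P.real (M ∩ R k) = P.real M * P.real (R k) := by
    have hX (t : ℝ≥0) : Measurable fun f : ℝ≥0 → ℝ ↦ f t := measurable_pi_apply t
    have hS (r T : ℝ≥0) (C : Set ℝ) (hC : MeasurableSet C) :
        MeasurableSet {f : ℝ≥0 → ℝ | (fun t ↦ f (r + t) - f r) ∈ dyadicPathsIn T C} :=
      (measurable_pi_lambda _ fun t ↦ (hX (r + t)).sub (hX r)) (measurableSet_dyadicPathsIn T hC)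
    have h1 := hZ.indep.symm.measure_inter_preimage_eq_mul
      ((fun f ↦ f s) ⁻¹' (Set.Icc u v) ∩
        {f : ℝ≥0 → ℝ | (fun t ↦ f (s + t) - f s) ∈ dyadicPathsIn h (Set.Icc (-η) η)})
      ((dyadicPathsIn s (Set.Icc (-δ) δ) ∩ {f : ℝ≥0 → ℝ | f (s + h) - f s ∈
        Set.Icc (ξ + 1 - a.re) (ξ + 1 - a.re + 1 / 2)}) ∩
        {f : ℝ≥0 → ℝ | (fun t ↦ f (s + h + t) - f (s + h)) ∈
          dyadicPathsIn (4 ^ k) (Set.Icc (-(1 / 2)) L)})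
      ((hX s measurableSet_Icc).inter (hS s h _ measurableSet_Icc))
      (((measurableSet_dyadicPathsIn s measurableSet_Icc).inter
        (((hX (s + h)).sub (hX s)) measurableSet_Icc)).inter
        (hS (s + h) (4 ^ k) _ measurableSet_Icc))
    simp only [measureReal_def]
    rw [← ENNReal.toReal_mul]
    exact congrArg ENNReal.toReal h1
  have hpaths : ∀ᵐ ω ∂P, ∀ k, ω ∈ M ∩ R k → 4 ^ k ≤ exitTime Z D ω := by
    filter_upwards [hZ.re.cont, hZ.im.cont] with ω cre cim k
    rintro ⟨⟨h1, h2⟩, ⟨⟨h3, h4⟩, h5⟩⟩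
    have key : ∀ t < (4 ^ k : ℝ≥0), Z t ω ∈ D := by
      intro t ht
      have hfin : ∀ r ≤ s, |(Z r ω).re - a.re| ≤ δ := fun r hr ↦ by
        simpa using abs_le.2 (forall_mem_of_mem_dyadicPathsIn cre isClosed_Icc h3 hr)
      rcases lt_or_ge t s with hts | hts
      · rcases hs with rfl | hs
        · exact absurd hts (not_lt.2 (zero_le))
        · exact hs _ (hfin t hts.le)
      rcases le_or_gt t (s + h) with htsh | htsh
      · have := forall_mem_of_mem_dyadicPathsIn
          ((cim.comp (continuous_const_add s)).sub continuous_const) isClosed_Icc h2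
          (t := t - s) (tsub_le_iff_left.2 htsh)
        simp only [Pi.sub_apply, Function.comp_apply, add_tsub_cancel_of_le hts] at this
        simp only [Set.mem_ofPred_eq, Set.mem_Icc, Complex.sub_im] at this h1
        exact hD _ (abs_lt.2 ⟨by linarith, by linarith⟩)
      · have := forall_mem_of_mem_dyadicPathsIn
          ((cre.comp (continuous_const_add (s + h))).sub continuous_const) isClosed_Icc h5
          (t := t - (s + h)) (tsub_le_self.trans ht.le)
        simp only [Pi.sub_apply, Function.comp_apply, add_tsub_cancel_of_le htsh.le] at this
        have h6 := abs_le.1 (hfin s le_rfl)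
        simp only [Set.mem_ofPred_eq, Set.mem_Icc, Complex.sub_re] at this h4
        -- At time `s + h` the real part lies in `[ξ + 1 - δ, ξ + 3/2 + δ]` with `δ ≤ 1/4`; an
        -- increment in `[-1/2, L]` keeps it strictly between `ξ` and `ξ + 2 + L`.
        exact hξ _ (by linarith) (by linarith)
    simpa using le_exitTime key
  refine le_trans (ENNReal.ofReal_le_ofReal ?_) (sum_two_pow_mul_measureReal_le_lintegral_rpow
    (fun k ↦ hMm.inter (hRm k)) hpaths hp m)
  rw [Finset.mul_sum]
  refine Finset.sum_le_sum fun k _ ↦ le_of_eq ?_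
  have e1 := hZ.im.measureReal_eval_inter_shift_dyadicPathsIn s h (C := Set.Icc u v)
    (C' := Set.Icc (-η) η) measurableSet_Icc measurableSet_Icc
  have e2 := hZ.re.measureReal_dyadicPathsIn_inter_increment_inter_shift s h (4 ^ k)
    (C := Set.Icc (-δ) δ) (C' := Set.Icc (ξ + 1 - a.re) (ξ + 1 - a.re + 1 / 2))
    (C'' := Set.Icc (-(1 / 2)) L) measurableSet_Icc measurableSet_Icc measurableSet_Icc
  rw [hMR, hM, hR]
  dsimp only
  rw [e1, e2]
  ring

/-! ### Geometry of the comb -/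

lemma isCombSequence_of_add_one_le {x : ℤ → ℝ} (hx : ∀ k, x k + 1 ≤ x (k + 1)) :
    IsCombSequence x where
  strictMono := strictMono_int_of_lt_succ fun k ↦ by linarith [hx k]
  no_accPt y hy := by
    have hmono : Monotone fun k : ℤ ↦ x k - k := monotone_int_of_le_succ fun k ↦ by
      push_cast; linarith [hx k]
    have hsep : ∀ i j : ℤ, i < j → 1 ≤ x j - x i := fun i j hij ↦ by
      have h1 := hmono hij.le
      have h2 : (i : ℝ) + 1 ≤ j := by exact_mod_cast hij
      dsimp only at h1
      linarith
    rw [accPt_iff_nhds] at hy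
    obtain ⟨_, ⟨hi, ⟨i, rfl⟩⟩, hiy⟩ := hy _ (Metric.ball_mem_nhds y (half_pos one_pos))
    -- The second point is strictly closer to `y` than the first, so the two are distinct yet less
    -- than `1` apart.
    obtain ⟨_, ⟨hj, ⟨j, rfl⟩⟩, hjy⟩ := hy _ (Metric.ball_mem_nhds y (dist_pos.2 hiy))
    rw [Metric.mem_ball, Real.dist_eq] at hi
    rw [Metric.mem_ball, Real.dist_eq, Real.dist_eq] at hj
    have hi' := abs_lt.1 hi
    have hj' := abs_lt.1 (hj.trans hi)
    rcases lt_trichotomy i j with h | rfl | h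
    · linarith [hsep i j h]
    · exact lt_irrefl _ hj
    · linarith [hsep j i h]

lemma mem_combDomain_one_iff {x : ℤ → ℝ} {z : ℂ} :
    z ∈ combDomain x (fun _ ↦ 1) ↔ ∀ n, z.re = x n → |z.im| < 1 := by
  simp only [combDomain, slit, Set.mem_compl_iff, Set.mem_iUnion, Set.mem_ofPred_eq, not_exists,
    not_and, not_or, not_le, abs_lt]
  exact forall₂_congr fun _ _ ↦ and_comm

lemma IsCombSequence.exists_pos_forall_lt_abs_sub {x : ℤ → ℝ} (hx : IsCombSequence x) {r : ℝ}
    (hr : ∀ n, r ≠ x n) : ∃ δ > 0, ∀ n, δ ≤ |x n - r| := by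
  have h : r ∉ closure (Set.range x) := by
    rw [closure_eq_self_union_derivedSet]
    rintro (⟨n, hn⟩ | h)
    · exact hr n hn.symm
    · exact hx.no_accPt r h
  obtain ⟨δ, hδ, h⟩ := Metric.mem_nhds_iff.1 (isClosed_closure.isOpen_compl.mem_nhds h)
  refine ⟨δ, hδ, fun n ↦ ?_⟩
  by_contra! hn
  exact h (show x n ∈ Metric.ball r δ by rwa [Metric.mem_ball, Real.dist_eq])
    (subset_closure ⟨n, rfl⟩)

/-- From every point of a comb domain with all heights `1`, the motion reaches the horizontal strip
`|Im z| < 1` within the domain with positive probability. -/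
lemma IsCombSequence.exists_parameters {x : ℤ → ℝ} (hx : IsCombSequence x) {a : ℂ}
    (ha : a ∈ combDomain x (fun _ ↦ 1)) :
    ∃ (s h : ℝ≥0) (δ η u v : ℝ), 0 < h ∧ h ≤ 1 ∧ δ ≤ 1 / 4 ∧
      (s = 0 ∨ ∀ z : ℂ, |z.re - a.re| ≤ δ → z ∈ combDomain x (fun _ ↦ 1)) ∧
      -1 < a.im + u - η ∧ a.im + v + η < 1 ∧
      ∀ {Ω : Type u} [MeasurableSpace Ω] {P : Measure Ω} {Z : ℝ≥0 → Ω → ℂ},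
        IsPlanarBrownian a Z P →
          0 < P.real {ω | (Z s ω - a).im ∈ Set.Icc u v} *
            P.real {ω | (fun t ↦ (Z (s + t) ω - a).im - (Z s ω - a).im) ∈
              dyadicPathsIn h (Set.Icc (-η) η)} *
            P.real {ω | (fun t ↦ (Z t ω - a).re) ∈ dyadicPathsIn s (Set.Icc (-δ) δ)} := by
  by_cases him : |a.im| < 1
  · have him' := abs_lt.1 him
    set η : ℝ := (1 - |a.im|) / 2 with hη
    have hη0 : 0 < η := by linarith
    have hη1 : η ≤ 1 := by linarith [abs_nonneg a.im]
    have hle := neg_abs_le a.im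
    have hle' := le_abs_self a.im
    have hhR : ((η ^ 2 / 8).toNNReal : ℝ) = η ^ 2 / 8 := Real.coe_toNNReal _ (by positivity)
    -- The motion already starts in the strip, so no time is needed to reach it.
    refine ⟨0, (η ^ 2 / 8).toNNReal, 1 / 4, η, 0, 0, ?_, ?_, le_rfl, Or.inl rfl, by linarith,
      by linarith, fun {Ω} _ P Z hZ ↦ mul_pos (mul_pos ?_ ?_) ?_⟩
    · exact NNReal.coe_pos.1 (by rw [hhR]; positivity)
    · exact NNReal.coe_le_coe.1 (by rw [hhR, NNReal.coe_one]; nlinarith)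
    · rw [hZ.im.measureReal_preimage_eval 0 measurableSet_Icc]
      simp [measureReal_def]
    · exact (hZ.im.shift 0).measureReal_dyadicPathsIn_Icc_pos hη0
        (by rw [hhR]; nlinarith)
    · exact hZ.re.measureReal_dyadicPathsIn_Icc_pos (by norm_num) (by norm_num)
  · have hre : ∀ n, a.re ≠ x n := fun n hn ↦ him (mem_combDomain_one_iff.1 ha n hn)
    obtain ⟨δ₀, hδ₀, hδ⟩ := hx.exists_pos_forall_lt_abs_sub hre
    set δ : ℝ := min (δ₀ / 2) (1 / 4)
    have hδ0 : 0 < δ := by positivity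
    have hδ1 : δ ≤ 1 / 4 := min_le_right _ _
    have hδ2 : δ < δ₀ := (min_le_left _ _).trans_lt (by linarith)
    set h : ℝ≥0 := (δ ^ 2 / 8).toNNReal
    have hhR : (h : ℝ) = δ ^ 2 / 8 := Real.coe_toNNReal _ (by positivity)
    have hpos : 0 < h := NNReal.coe_pos.1 (by rw [hhR]; positivity)
    -- The imaginary part is sent to `[-1/4, 1/4]` and may then move by `1/2`, while the real part
    -- stays in a vertical strip free of slits.
    refine ⟨h, h, δ, 1 / 2, -a.im - 1 / 4, -a.im - 1 / 4 + 1 / 2, hpos, ?_, hδ1, Or.inr ?_,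
      by linarith, by linarith, fun {Ω} _ P Z hZ ↦ mul_pos (mul_pos ?_ ?_) ?_⟩
    · exact NNReal.coe_le_coe.1 (by rw [hhR, NNReal.coe_one]; nlinarith)
    · refine fun z hz ↦ mem_combDomain_one_iff.2 fun n hn ↦ ?_
      rw [hn] at hz
      linarith [hδ n]
    · rw [hZ.im.measureReal_preimage_eval h measurableSet_Icc]
      refine lt_of_lt_of_le ?_ (le_gaussianReal_Icc hpos.ne' (R := |a.im| + 1) (by norm_num) ?_)
      · positivity
      · intro y hy
        have := neg_abs_le a.im
        have := le_abs_self a.im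
        exact abs_le.2 ⟨by linarith [hy.1], by linarith [hy.2]⟩
    · exact (hZ.im.shift h).measureReal_dyadicPathsIn_Icc_pos (by norm_num)
        (by rw [hhR]; nlinarith)
    · exact hZ.re.measureReal_dyadicPathsIn_Icc_pos hδ0 (by rw [hhR]; nlinarith)

/-! ### Recursive choice of the gaps and conclusion -/

/-- A lower bound for the probability that a Gaussian variable with variance between `1 / n` and `1`
lies in a given interval of length `1 / 2` at distance at most `|ξ| + n + 2` from the origin. -/
noncomputable def gaussianIntervalBound (n : ℕ) (ξ : ℝ) : ℝ :=
  1 / 2 * ((√(2 * Real.pi))⁻¹ * Real.exp (-(n * (|ξ| + n + 2) ^ 2 / 2)))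

lemma gaussianIntervalBound_pos (n : ℕ) (ξ : ℝ) : 0 < gaussianIntervalBound n ξ := by
  unfold gaussianIntervalBound; positivity

lemma gaussianIntervalBound_le {n : ℕ} {ξ r : ℝ} {v : ℝ≥0} (hv : 0 < v) (hv1 : v ≤ 1)
    (hvn : (v : ℝ)⁻¹ ≤ n) (hr : |r| ≤ n) :
    gaussianIntervalBound n ξ ≤
      (gaussianReal 0 v).real (Set.Icc (ξ + 1 - r) (ξ + 1 - r + 1 / 2)) := by
  have hv0 : (0 : ℝ) < v := by exact_mod_cast hv
  refine le_trans ?_ (le_gaussianReal_Icc hv.ne' (R := |ξ| + n + 2) (by norm_num) ?_)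
  · unfold gaussianIntervalBound
    gcongr ?_ * (?_ * Real.exp ?_)
    · apply inv_anti₀ (by positivity)
      apply Real.sqrt_le_sqrt
      have : (v : ℝ) ≤ 1 := by exact_mod_cast hv1
      exact mul_le_of_le_one_right (by positivity) this
    · rw [neg_div, neg_le_neg_iff]
      calc (|ξ| + n + 2) ^ 2 / (2 * v) = (v : ℝ)⁻¹ * (|ξ| + n + 2) ^ 2 / 2 := by field_simp
        _ ≤ _ := by gcongr
  · intro y hy
    have := abs_le.1 hr
    have := neg_abs_le ξ
    have := le_abs_self ξ
    exact abs_le.2 ⟨by linarith [hy.1], by linarith [hy.2]⟩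

/-- Partial sums of the gaps `2 + L n y`, each of which may depend on the previous sum `y`. -/
noncomputable def gapSum (L : ℕ → ℝ → ℝ) : ℕ → ℝ
  | 0 => 0
  | n + 1 => gapSum L n + 2 + L n (gapSum L n)

theorem mainTheorem2 (p : ℝ) (hp : 1 / 2 ≤ p) :
    ∃ x : ℤ → ℝ, IsCombSequence x ∧
      ∀ a ∈ combDomain x (fun _ ↦ 1),
        ∀ (Ω : Type*) [MeasurableSpace Ω] (P : Measure Ω) [IsProbabilityMeasure P]
          (Z : ℝ≥0 → Ω → ℂ), IsPlanarBrownian a Z P →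
            ∫⁻ ω, exitTime Z (combDomain x (fun _ ↦ 1)) ω ^ p ∂P = ∞ := by
  choose L m hL hLm using exists_le_sum_measureReal_dyadicPathsIn
  -- The sequence must be fixed before `a`. The bound therefore depends only on `n` and `ξ`, and `n`
  -- eventually dominates both `1 / h` and `|a.re|`.
  let K : ℕ → ℝ → ℝ := fun n ξ ↦ n / gaussianIntervalBound n ξ
  let y : ℕ → ℝ := gapSum fun n ξ ↦ L (K n ξ)
  have hy (n : ℕ) : y (n + 1) = y n + 2 + L (K n (y n)) := rfl
  -- Only the gaps on the right matter; to the left of `0` the slits are at the negative integers.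
  let x : ℤ → ℝ := fun k ↦ y k.toNat + (min k 0 : ℤ)
  have hxy (n : ℕ) : x n = y n := by simp [x]
  have hx : IsCombSequence x := by
    refine isCombSequence_of_add_one_le fun k ↦ ?_
    rcases lt_or_ge k 0 with hk | hk
    · simp only [x]
      rw [Int.toNat_of_nonpos hk.le, Int.toNat_of_nonpos hk, min_eq_left hk.le, min_eq_left hk]
      push_cast
      linarith
    · lift k to ℕ using hk
      have : x (k + 1) = y (k + 1) := by exact_mod_cast hxy (k + 1)
      rw [hxy, this, hy]
      linarith [hL (K k (y k))]
  refine ⟨x, hx, fun a ha Ω _ P _ Z hZ ↦ ?_⟩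
  obtain ⟨s, h, δ, η, u, v, hh0, hh1, hδ, hs, hu, hv, hpos⟩ := hx.exists_parameters ha
  specialize hpos hZ
  set α : ℝ := P.real {ω | (Z s ω - a).im ∈ Set.Icc u v} *
    P.real {ω | (fun t ↦ (Z (s + t) ω - a).im - (Z s ω - a).im) ∈
      dyadicPathsIn h (Set.Icc (-η) η)} *
    P.real {ω | (fun t ↦ (Z t ω - a).re) ∈ dyadicPathsIn s (Set.Icc (-δ) δ)} with hα
  have hbound (n : ℕ) (hn : (h : ℝ)⁻¹ ≤ n) (hn' : |a.re| ≤ n) :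
      ENNReal.ofReal (α * n) ≤ 2 * ∫⁻ ω, exitTime Z (combDomain x (fun _ ↦ 1)) ω ^ p ∂P := by
    have hξ (z : ℂ) (h1 : y n < z.re) (h2 : z.re < y n + 2 + L (K n (y n))) :
        z ∈ combDomain x (fun _ ↦ 1) := by
      refine mem_combDomain_one_iff.2 fun k hk ↦ ?_
      rw [← hxy, hk] at h1
      rw [← hy, ← hxy, hk] at h2
      have h3 := hx.strictMono.lt_iff_lt.1 h1
      have h4 := hx.strictMono.lt_iff_lt.1 h2
      push_cast at h4
      omega
    refine le_trans (ENNReal.ofReal_le_ofReal ?_) (hZ.ofReal_le_lintegral_exitTime_rpow (h := h)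
      hδ hs hu hv (fun z hz ↦ mem_combDomain_one_iff.2 fun _ _ ↦ hz) hξ hp (m (K n (y n))))
    rw [← hα]
    have hinc : gaussianIntervalBound n (y n) ≤ P.real {ω | (Z (s + h) ω - a).re - (Z s ω - a).re ∈
        Set.Icc (y n + 1 - a.re) (y n + 1 - a.re + 1 / 2)} :=
      (gaussianIntervalBound_le hh0 hh1 hn hn').trans_eq
        ((hZ.re.shift s).measureReal_preimage_eval h measurableSet_Icc).symm
    have hg := gaussianIntervalBound_pos n (y n)
    calc α * n = α * gaussianIntervalBound n (y n) * K n (y n) := by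
          simp only [K]; field_simp
      _ ≤ _ := by
          gcongr
          exact hLm (K n (y n)) Ω P _ (hZ.re.shift (s + h)).toIsPreBrownianReal
  by_contra hfin
  have hfin' : 2 * ∫⁻ ω, exitTime Z (combDomain x (fun _ ↦ 1)) ω ^ p ∂P ≠ ∞ :=
    ENNReal.mul_ne_top (by simp) hfin
  obtain ⟨n, hn⟩ := exists_nat_gt (max (max (h : ℝ)⁻¹ |a.re|)
    ((2 * ∫⁻ ω, exitTime Z (combDomain x (fun _ ↦ 1)) ω ^ p ∂P).toReal / α))
  simp only [max_lt_iff] at hn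
  have h1 := (ENNReal.ofReal_le_iff_le_toReal hfin').1 (hbound n hn.1.1.le hn.1.2.le)
  have h2 := (div_lt_iff₀ hpos).1 hn.2
  linarith
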